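/- There is an absolute constant $C>0$ with the following property. Let $n\ge 1$, let $V:\mathbb{R}^n\to\mathbb{R}$ be bounded and continuous with $V(x)>0$ for all $x\in\mathbb{R}^n$, and let $u_0\in H^2(\mathbb{R}^n)$, $u_1\in L^2(\mathbb{R}^n)$ be real-valued with $$K_{0,p}^2:=\int_{\mathbb{R}^n}\frac{|u_1(x)|^2}{V(x)}\,dx<\infty .$$ Then the Cauchy problem $$u_{tt}+\Delta^2u+V(x)u=0\quad (t>0,\ x\in\mathbb{R}^n),\qquad u(0,x)=u_0(x),\quad u_t(0,x)=u_1(x)\quad (x\in\mathbb{R}^n)$$ has a unique weak solution $u\in C([0,\infty);H^2(\mathbb{R}^n))\cap C^1([0,\infty);L^2(\mathbb{R}^n))$, and it satisfies $$\|u(t,\cdot)\|^2\le C\left(\|u_0\|^2+K_{0,p}^2\right)\qquad\text{for all } t\ge 0,$$ where $\|\cdot\|$ is the norm of $L^2(\mathbb{R}^n)$. Here $u$ is a weak solution if $u(0)=u_0$, $u_t(0)=u_1$ and, for every $\varphi\in H^2(\mathbb{R}^n)$ and every $t\ge 0$ (with a one-sided derivative at $t=0$), $$\frac{d}{dt}\int_{\mathbb{R}^n}u_t\,\varphi\,dx+\int_{\mathbb{R}^n}\Delta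 u\,\Delta\varphi\,dx+\int_{\mathbb{R}^n}V\,u\,\varphi\,dx=0 .$$ -/

import Mathlib

open MeasureTheory Set
open scoped ContDiff BoundedContinuousFunction

namespace Plate

/-- The Euclidean space `ℝⁿ`. -/
abbrev Rn (n : ℕ) : Type := EuclideanSpace ℝ (Fin n)

/-- Real-valued `L²(ℝⁿ)` with respect to Lebesgue measure. -/
abbrev L2 (n : ℕ) : Type := Lp ℝ 2 (volume : Measure (Rn n))

/-- `g` is the weak partial derivative `∂ᵢ f`, tested against `C_c^∞(ℝⁿ)`. -/
def HasWeakPartial {n : ℕ} (i : Fin n) (f g : L2 n) : Prop :=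
  ∀ φ : Rn n → ℝ, ContDiff ℝ ∞ φ → HasCompactSupport φ →
    ∫ x, f x * fderiv ℝ φ x (EuclideanSpace.single i 1) = - ∫ x, g x * φ x

theorem integrable_L2_mul {n : ℕ} (f : L2 n) {ψ : Rn n → ℝ} (hψ : Continuous ψ)
    (hc : HasCompactSupport ψ) : Integrable (fun x => f x * ψ x) :=
  (Lp.memLp f).integrable_mul (hψ.memLp_of_hasCompactSupport (p := 2) hc)

theorem integrable_L2_mul_fderiv {n : ℕ} (i : Fin n) (f : L2 n) {φ : Rn n → ℝ}
    (hφ : ContDiff ℝ ∞ φ) (hc : HasCompactSupport φ) :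
    Integrable (fun x => f x * fderiv ℝ φ x (EuclideanSpace.single i 1)) :=
  integrable_L2_mul f ((hφ.continuous_fderiv (by simp)).clm_apply continuous_const)
    (hc.fderiv_apply ℝ _)

theorem HasWeakPartial.zero {n : ℕ} (i : Fin n) : HasWeakPartial i (0 : L2 n) 0 := by
  intro φ _ _
  have h0 : ((0 : L2 n) : Rn n → ℝ) =ᵐ[volume] 0 := Lp.coeFn_zero _ _ _
  rw [integral_eq_zero_of_ae, integral_eq_zero_of_ae, neg_zero]
  · filter_upwards [h0] with x hx
    rw [hx, Pi.zero_apply, zero_mul]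
  · filter_upwards [h0] with x hx
    rw [hx, Pi.zero_apply, zero_mul]

theorem HasWeakPartial.add {n : ℕ} {i : Fin n} {f g f' g' : L2 n} (h : HasWeakPartial i f g)
    (h' : HasWeakPartial i f' g') : HasWeakPartial i (f + f') (g + g') := by
  intro φ hφ hc
  have e1 : ∫ x, (f + f' : L2 n) x * fderiv ℝ φ x (EuclideanSpace.single i 1)
      = ∫ x, (f x * fderiv ℝ φ x (EuclideanSpace.single i 1)
        + f' x * fderiv ℝ φ x (EuclideanSpace.single i 1)) := by
    apply integral_congr_ae
    filter_upwards [Lp.coeFn_add f f'] with x hx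
    rw [hx, Pi.add_apply, add_mul]
  have e2 : ∫ x, (g + g' : L2 n) x * φ x = ∫ x, (g x * φ x + g' x * φ x) := by
    apply integral_congr_ae
    filter_upwards [Lp.coeFn_add g g'] with x hx
    rw [hx, Pi.add_apply, add_mul]
  rw [e1, e2, integral_add (integrable_L2_mul_fderiv i f hφ hc)
    (integrable_L2_mul_fderiv i f' hφ hc), integral_add (integrable_L2_mul g hφ.continuous hc)
    (integrable_L2_mul g' hφ.continuous hc), h φ hφ hc, h' φ hφ hc]
  ring

theorem HasWeakPartial.smul {n : ℕ} {i : Fin n} {f g : L2 n} (c : ℝ)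
    (h : HasWeakPartial i f g) : HasWeakPartial i (c • f) (c • g) := by
  intro φ hφ hc
  have e1 : ∫ x, (c • f : L2 n) x * fderiv ℝ φ x (EuclideanSpace.single i 1)
      = ∫ x, c * (f x * fderiv ℝ φ x (EuclideanSpace.single i 1)) := by
    apply integral_congr_ae
    filter_upwards [Lp.coeFn_smul c f] with x hx
    rw [hx, Pi.smul_apply, smul_eq_mul, mul_assoc]
  have e2 : ∫ x, (c • g : L2 n) x * φ x = ∫ x, c * (g x * φ x) := by
    apply integral_congr_ae
    filter_upwards [Lp.coeFn_smul c g] with x hx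
    rw [hx, Pi.smul_apply, smul_eq_mul, mul_assoc]
  rw [e1, e2, integral_const_mul, integral_const_mul, h φ hφ hc]
  ring

/-- The Sobolev space `H²(ℝⁿ)`, realised as the space of triples `(f, ∇f, D²f)` of an `L²`
function and its weak partial derivatives of order one and two, all in `L²`. The triple is
determined by `f`. The norm inherited from the product (the maximum of the `L²` norms of the
components) is equivalent to the usual norm of `H²`, so the topology is the usual one. -/
def H2 (n : ℕ) : Submodule ℝ (L2 n × (Fin n → L2 n) × (Fin n → Fin n → L2 n)) where
  carrier := {p | (∀ i, HasWeakPartial i p.1 (p.2.1 i)) ∧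
    ∀ i j, HasWeakPartial j (p.2.1 i) (p.2.2 i j)}
  zero_mem' := ⟨fun i => HasWeakPartial.zero i, fun _ j => HasWeakPartial.zero j⟩
  add_mem' := fun ha hb =>
    ⟨fun i => (ha.1 i).add (hb.1 i), fun i j => (ha.2 i j).add (hb.2 i j)⟩
  smul_mem' := fun c _ ha =>
    ⟨fun i => (ha.1 i).smul c, fun i j => (ha.2 i j).smul c⟩

/-- The underlying `L²` function of an element of `H²`. -/
def toL2 {n : ℕ} (f : H2 n) : L2 n := f.1.1

/-- The weak Laplacian `Δ f = ∑ᵢ ∂ᵢ∂ᵢ f ∈ L²` of `f ∈ H²`. -/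
noncomputable def laplacian {n : ℕ} (f : H2 n) : L2 n := ∑ i, f.1.2.2 i i

/-- `u ∈ C([0,∞); H²) ∩ C¹([0,∞); L²)` is a weak solution of `u_tt + Δ² u + V u = 0` with
`u(0) = u₀`, `u_t(0) = u₁`: for every `φ ∈ H²` and `t ≥ 0`,
`d/dt (u_t, φ) + (Δu, Δφ) + ∫ V u φ = 0` (one-sided derivatives at `t = 0`).
Only the values `u t` with `t ≥ 0` matter. -/
structure IsPlateSolution {n : ℕ} (V : Rn n →ᵇ ℝ) (u₀ : H2 n) (u₁ : L2 n)
    (u : ℝ → H2 n) : Prop where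
  continuousOn : ContinuousOn u (Ici 0)
  initial : u 0 = u₀
  velocity : ∃ ut : ℝ → L2 n, ContinuousOn ut (Ici 0) ∧ ut 0 = u₁ ∧
    (∀ t, 0 ≤ t → HasDerivWithinAt (fun s => toL2 (u s)) (ut t) (Ici 0) t) ∧
    ∀ φ : H2 n, ∀ t, 0 ≤ t →
      HasDerivWithinAt (fun s => inner ℝ (ut s) (toL2 φ))
        (-(inner ℝ (laplacian (u t)) (laplacian φ) + ∫ x, V x * toL2 (u t) x * toL2 φ x))
        (Ici 0) t

end Plate

/-!
The estimate is the energy identity for the time primitive `U = ∫₀ᵗ u` rather than for `u`. The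
equation integrated in time reads `u_t + Δ² U + V U = u₁`; tested with `u = U_t` it shows that
`‖u‖² + ‖ΔU‖² + ∫ V U² - 2 (u₁, U)` is conserved, with value `‖u₀‖²` at `t = 0`. Since
`2 (u₁, U) ≤ ∫ u₁² / V + ∫ V U²`, the bound holds with `C = 1`. Uniqueness is the same identity for
zero data, and testing with `u` itself is legitimate because `u(t) ∈ H²`, whereas `u_t` need not be.

Existence is semigroup theory for the first-order system on the product of the form domain and
`L²`: its shifted generator has a firmly nonexpansive resolvent, and the exponentials of its Yosida
approximations converge. The form domain is `H²` because `‖D²f‖ = ‖Δf‖`, so that the graph norm of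
`Δ` is an `H²` norm.
-/

namespace Plate

open Filter Topology
open scoped InnerProductSpace

section HalfLine

variable {E : Type*} [NormedAddCommGroup E] [NormedSpace ℝ E]

theorem hasDerivWithinAt_integral_Ici [CompleteSpace E] {g : ℝ → E}
    (hg : ContinuousOn g (Ici 0)) {t : ℝ} (ht : 0 ≤ t) :
    HasDerivWithinAt (fun s => ∫ r in (0 : ℝ)..s, g r) (g t) (Ici 0) t := by
  have hg' : Continuous fun r => g (max r 0) :=
    hg.comp_continuous (by fun_prop) fun r => le_max_right r 0
  have heq : ∀ s ∈ Ici (0 : ℝ), ∫ r in (0 : ℝ)..s, g r = ∫ r in (0 : ℝ)..s, g (max r 0) := by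
    intro s hs
    refine intervalIntegral.integral_congr fun r hr => ?_
    rw [uIcc_of_le hs] at hr
    simp only [max_eq_left hr.1]
  have h := (hg'.integral_hasStrictDerivAt 0 t).hasDerivAt.hasDerivWithinAt (s := Ici 0)
  simp only [max_eq_left ht] at h
  exact h.congr heq (heq t ht)

theorem eq_of_hasDerivWithinAt_Ici_zero {F : ℝ → E}
    (h : ∀ t, 0 ≤ t → HasDerivWithinAt F 0 (Ici 0) t) {t : ℝ} (ht : 0 ≤ t) : F t = F 0 :=
  constant_of_has_deriv_right_zero (a := 0) (b := t)
    (fun s hs => (h s hs.1).continuousWithinAt.mono fun _ hr => hr.1)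
    (fun s hs => (h s hs.1).mono (Ici_subset_Ici.2 hs.1)) t ⟨ht, le_rfl⟩

end HalfLine

theorem tendsto_zero_of_denseRange {ι α X Y : Type*} [NormedAddCommGroup X] [NormedSpace ℝ X]
    [NormedAddCommGroup Y] [NormedSpace ℝ Y] {l : Filter ι} {T : ι → X →L[ℝ] Y} {C : ℝ}
    (hT : ∀ᶠ i in l, ∀ x, ‖T i x‖ ≤ C * ‖x‖) {f : α → X} (hf : DenseRange f)
    (h : ∀ a, Tendsto (fun i => T i (f a)) l (𝓝 0)) (x : X) :
    Tendsto (fun i => T i x) l (𝓝 0) := by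
  rw [Metric.tendsto_nhds]
  intro η hη
  obtain ⟨a, ha⟩ := hf.exists_dist_lt x (show 0 < η / (2 * (|C| + 1)) by positivity)
  rw [dist_eq_norm, lt_div_iff₀ (by positivity)] at ha
  filter_upwards [hT, (Metric.tendsto_nhds.1 (h a)) (η / 2) (half_pos hη)] with i hi ha'
  rw [dist_zero_right] at ha' ⊢
  calc ‖T i x‖ = ‖T i (x - f a) + T i (f a)‖ := by rw [map_sub, sub_add_cancel]
    _ ≤ C * ‖x - f a‖ + ‖T i (f a)‖ := (norm_add_le _ _).trans (by gcongr; exact hi _)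
    _ < η := by nlinarith [le_abs_self C, norm_nonneg (x - f a)]

section Exponential

theorem hasDerivAt_exp_smul_apply {E : Type*} [NormedAddCommGroup E] [NormedSpace ℝ E]
    [CompleteSpace E] (G : E →L[ℝ] E) (x : E) (t : ℝ) :
    HasDerivAt (fun s : ℝ => NormedSpace.exp (s • G) x) (G (NormedSpace.exp (t • G) x)) t :=
  (ContinuousLinearMap.apply ℝ E x).hasFDerivAt.comp_hasDerivAt t
    (hasDerivAt_exp_smul_const' (𝕂 := ℝ) G t)

theorem continuous_exp_smul_apply {E : Type*} [NormedAddCommGroup E] [NormedSpace ℝ E]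
    [CompleteSpace E] (G : E →L[ℝ] E) (x : E) :
    Continuous fun s : ℝ => NormedSpace.exp (s • G) x :=
  continuous_iff_continuousAt.2 fun t => (hasDerivAt_exp_smul_apply G x t).continuousAt

variable {X : Type*} [NormedAddCommGroup X] [InnerProductSpace ℝ X] [CompleteSpace X]

theorem norm_exp_smul_apply_le {G : X →L[ℝ] X} (hG : ∀ x, ⟪G x, x⟫_ℝ ≤ 0) (x : X) {t : ℝ}
    (ht : 0 ≤ t) : ‖NormedSpace.exp (t • G) x‖ ≤ ‖x‖ := by
  have hderiv := fun s => (hasDerivAt_exp_smul_apply G x s).norm_sq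
  have hanti : Antitone fun s : ℝ => ‖NormedSpace.exp (s • G) x‖ ^ 2 := by
    refine antitone_of_hasDerivAt_nonpos hderiv fun s => ?_
    change 2 * _ ≤ 0
    rw [real_inner_comm]
    linarith [hG (NormedSpace.exp (s • G) x)]
  have h := hanti ht
  simp only [zero_smul, NormedSpace.exp_zero, one_apply_eq_self] at h
  exact le_of_sq_le_sq h (norm_nonneg _)

theorem norm_exp_smul_sub_exp_smul_apply_le {G G' : X →L[ℝ] X} (hG : ∀ x, ⟪G x, x⟫_ℝ ≤ 0)
    (hG' : ∀ x, ⟪G' x, x⟫_ℝ ≤ 0) (hcomm : Commute G G') (x : X) {t : ℝ} (ht : 0 ≤ t) :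
    ‖NormedSpace.exp (t • G) x - NormedSpace.exp (t • G') x‖ ≤ t * ‖G x - G' x‖ := by
  have hGexp : ∀ (s : ℝ) y,
      G (NormedSpace.exp (s • G') y) = NormedSpace.exp (s • G') (G y) := fun s y =>
    congrArg (· y) (hcomm.smul_right s).exp_right.eq
  have hG'exp : ∀ (s : ℝ) y,
      G' (NormedSpace.exp (s • G') y) = NormedSpace.exp (s • G') (G' y) := fun s y =>
    congrArg (· y) ((Commute.refl G').smul_right s).exp_right.eq
  -- Interpolate between the two exponentials by `s ↦ e^{sG} e^{(t-s)G'} x`.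
  have hderiv : ∀ s, HasDerivAt
      (fun s => NormedSpace.exp (s • G) (NormedSpace.exp ((t - s) • G') x))
      (NormedSpace.exp (s • G) (NormedSpace.exp ((t - s) • G') (G x - G' x))) s := by
    intro s
    have h := (hasDerivAt_exp_smul_const (𝕂 := ℝ) G s).clm_apply
      ((hasDerivAt_exp_smul_apply G' x (t - s)).comp_const_sub t s)
    refine h.congr_deriv ?_
    rw [mul_apply_eq_comp, hGexp, hG'exp, map_neg, ← sub_eq_add_neg, ← map_sub, ← map_sub]
  have hbound := norm_image_sub_le_of_norm_deriv_le_segment' (a := 0) (b := t)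
    (fun s _ => (hderiv s).hasDerivWithinAt) (fun s hs =>
      (norm_exp_smul_apply_le hG _ hs.1).trans
        (norm_exp_smul_apply_le hG' _ (sub_nonneg.2 hs.2.le))) t ⟨ht, le_rfl⟩
  simpa [mul_comm t] using hbound

end Exponential

theorem commute_ringInverse {M₀ : Type*} [MonoidWithZero M₀] {a b : M₀} (h : Commute a b) :
    Commute a (Ring.inverse b) := by
  by_cases hb : IsUnit b
  · obtain ⟨u, rfl⟩ := hb
    rw [Ring.inverse_unit]
    exact h.units_inv_right
  · rw [Ring.inverse_non_unit b hb]
    exact Commute.zero_right a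

section Generation

variable {X : Type*} [NormedAddCommGroup X] [InnerProductSpace ℝ X]

/-- `R` is firmly nonexpansive. For injective `R` this says that `R` is the resolvent `(1 - G)⁻¹`
of the dissipative operator `G = 1 - R⁻¹`, whose domain is the range of `R`; speaking of `R` avoids
unbounded operators. -/
def FirmlyNonexpansive (R : X →L[ℝ] X) : Prop := ∀ z, ‖R z‖ ^ 2 ≤ ⟪z, R z⟫_ℝ

/-- The resolvent `(1 - ε G)⁻¹` of `G = 1 - R⁻¹`. It takes the junk value `0` where
`(1 - ε) R + ε` is not invertible, which does not happen for `R` firmly nonexpansive and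
`0 < ε ≤ 1`. -/
noncomputable def yosidaResolvent (R : X →L[ℝ] X) (ε : ℝ) : X →L[ℝ] X :=
  R * Ring.inverse ((1 - ε) • R + ε • 1)

/-- The Yosida approximation `G (1 - ε G)⁻¹` of `G = 1 - R⁻¹`, with the same junk values as
`yosidaResolvent`. -/
noncomputable def yosida (R : X →L[ℝ] X) (ε : ℝ) : X →L[ℝ] X :=
  (R - 1) * Ring.inverse ((1 - ε) • R + ε • 1)

theorem commute_ringInverse_smul_add_smul_one {R S : X →L[ℝ] X} (h : Commute S R) (ε : ℝ) :
    Commute S (Ring.inverse ((1 - ε) • R + ε • 1)) :=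
  commute_ringInverse ((h.smul_right _).add_right ((Commute.one_right S).smul_right ε))

theorem commute_yosida_of_commute {R S : X →L[ℝ] X} (h : Commute S R) (ε : ℝ) :
    Commute S (yosida R ε) :=
  (h.sub_right (Commute.one_right S)).mul_right (commute_ringInverse_smul_add_smul_one h ε)

theorem commute_yosida_yosida (R : X →L[ℝ] X) (ε δ : ℝ) : Commute (yosida R ε) (yosida R δ) :=
  commute_yosida_of_commute (commute_yosida_of_commute (Commute.refl R) ε).symm δ

theorem apply_yosida (R : X →L[ℝ] X) (ε : ℝ) (x : X) :
    R (yosida R ε x) = yosidaResolvent R ε (R x - x) := by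
  have h : R * yosida R ε = yosidaResolvent R ε * (R - 1) := by
    rw [yosida, yosidaResolvent, mul_assoc, (commute_ringInverse_smul_add_smul_one
      ((Commute.refl R).sub_left (Commute.one_left R)) ε).eq]
  exact congrArg (· x) h

theorem yosida_apply_apply (R : X →L[ℝ] X) (ε : ℝ) (x : X) :
    yosida R ε (R x) = yosidaResolvent R ε (R x - x) := by
  rw [← apply_yosida]
  exact congrArg (· x) (commute_yosida_of_commute (Commute.refl R) ε).eq.symm

namespace FirmlyNonexpansive

variable {R : X →L[ℝ] X} {ε : ℝ}

theorem norm_apply_le (hR : FirmlyNonexpansive R) (x : X) : ‖R x‖ ≤ ‖x‖ := by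
  have h := (hR x).trans (real_inner_le_norm x (R x))
  rcases (norm_nonneg (R x)).eq_or_lt' with h0 | h0
  · rw [h0]
    exact norm_nonneg x
  · rw [sq] at h
    exact le_of_mul_le_mul_right h h0

variable [CompleteSpace X]

theorem denseRange (hR : FirmlyNonexpansive R) (hinj : Function.Injective R) : DenseRange R := by
  suffices h : (R.range)ᗮ = ⊥ from Submodule.dense_iff_topologicalClosure_eq_top.2
    (Submodule.topologicalClosure_eq_top_iff.2 h)
  refine (Submodule.eq_bot_iff _).2 fun z hz => hinj ?_
  have h := hR z
  rw [real_inner_comm, (Submodule.mem_orthogonal _ z).1 hz (R z) ⟨z, rfl⟩] at h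
  rw [map_zero, ← norm_eq_zero]
  exact pow_eq_zero_iff two_ne_zero |>.1 (le_antisymm h (sq_nonneg _))

theorem isUnit_smul_add_smul_one (hR : FirmlyNonexpansive R) (h0 : 0 < ε) (h1 : ε ≤ 1) :
    IsUnit ((1 - ε) • R + ε • (1 : X →L[ℝ] X)) := by
  refine ContinuousLinearMap.isUnit_of_forall_le_norm_inner_map _ (c := ⟨ε, h0.le⟩) h0 fun z => ?_
  refine le_trans ?_ (le_abs_self _)
  have h := (sq_nonneg _).trans (hR z)
  rw [real_inner_comm] at h
  change ‖z‖ ^ 2 * ε ≤ _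
  simp only [add_apply, smul_apply, one_apply_eq_self, inner_add_left,
    real_inner_smul_left, real_inner_self_eq_norm_sq]
  linarith [mul_nonneg (sub_nonneg.2 h1) h]

theorem exists_resolvent_preimage (hR : FirmlyNonexpansive R) (h0 : 0 < ε) (h1 : ε ≤ 1) (x : X) :
    ∃ z, x = (1 - ε) • R z + ε • z ∧ yosidaResolvent R ε x = R z ∧ yosida R ε x = R z - z := by
  refine ⟨Ring.inverse ((1 - ε) • R + ε • 1) x, ?_, rfl, rfl⟩
  exact congrArg (· x) (Ring.mul_inverse_cancel _ (hR.isUnit_smul_add_smul_one h0 h1)).symm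

theorem yosidaResolvent_apply_sub (hR : FirmlyNonexpansive R) (h0 : 0 < ε) (h1 : ε ≤ 1) (x : X) :
    yosidaResolvent R ε x - x = ε • yosida R ε x := by
  obtain ⟨z, hx, hJ, hG⟩ := hR.exists_resolvent_preimage h0 h1 x
  rw [hJ, hG, hx]
  module

theorem firmlyNonexpansive_yosidaResolvent (hR : FirmlyNonexpansive R) (h0 : 0 < ε)
    (h1 : ε ≤ 1) : FirmlyNonexpansive (yosidaResolvent R ε) := by
  intro x
  obtain ⟨z, hx, hJ, -⟩ := hR.exists_resolvent_preimage h0 h1 x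
  rw [hJ, hx, inner_add_left, real_inner_smul_left, real_inner_smul_left,
    real_inner_self_eq_norm_sq]
  linarith [mul_le_mul_of_nonneg_left (hR z) h0.le]

theorem inner_yosida_nonpos (hR : FirmlyNonexpansive R) (h0 : 0 < ε) (h1 : ε ≤ 1) (x : X) :
    ⟪yosida R ε x, x⟫_ℝ ≤ 0 := by
  obtain ⟨z, hx, -, hG⟩ := hR.exists_resolvent_preimage h0 h1 x
  have hdecomp : x = R z - ε • (R z - z) := by
    rw [hx]
    module
  rw [hG, hdecomp, inner_sub_right, real_inner_smul_right, real_inner_self_eq_norm_sq,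
    inner_sub_left, real_inner_self_eq_norm_sq]
  linarith [hR z, mul_nonneg h0.le (sq_nonneg ‖R z - z‖)]

theorem tendsto_yosidaResolvent_apply (hR : FirmlyNonexpansive R)
    (hinj : Function.Injective R) (x : X) :
    Tendsto (fun ε => yosidaResolvent R ε x) (𝓝[>] 0) (𝓝 x) := by
  suffices h : Tendsto (fun ε => (yosidaResolvent R ε - 1) x) (𝓝[>] 0) (𝓝 0) by
    simpa using h.add_const x
  refine tendsto_zero_of_denseRange (C := 2) ?_ (hR.denseRange hinj) (fun w => ?_) x
  · filter_upwards [Ioc_mem_nhdsGT one_pos] with ε hε x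
    rw [sub_apply, one_apply_eq_self, two_mul]
    exact norm_sub_le_of_le
      ((hR.firmlyNonexpansive_yosidaResolvent hε.1 hε.2).norm_apply_le x) le_rfl
  · have hlim : Tendsto (fun ε : ℝ => ε * ‖R w - w‖) (𝓝[>] 0) (𝓝 0) := by
      simpa using ((tendsto_id (x := 𝓝 (0 : ℝ))).mono_left nhdsWithin_le_nhds).mul_const ‖R w - w‖
    refine squeeze_zero_norm' ?_ hlim
    filter_upwards [Ioc_mem_nhdsGT one_pos] with ε hε
    rw [sub_apply, one_apply_eq_self, hR.yosidaResolvent_apply_sub hε.1 hε.2, yosida_apply_apply,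
      norm_smul, Real.norm_of_nonneg hε.1.le]
    exact mul_le_mul_of_nonneg_left
      ((hR.firmlyNonexpansive_yosidaResolvent hε.1 hε.2).norm_apply_le _) hε.1.le

theorem tendsto_yosidaResolvent_apply_of_tendsto (hR : FirmlyNonexpansive R)
    (hinj : Function.Injective R) {y : ℝ → X} {x : X} (hy : Tendsto y (𝓝[>] 0) (𝓝 x)) :
    Tendsto (fun ε => yosidaResolvent R ε (y ε)) (𝓝[>] 0) (𝓝 x) := by
  have h : Tendsto (fun ε => yosidaResolvent R ε (y ε - x)) (𝓝[>] 0) (𝓝 0) := by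
    refine squeeze_zero_norm' ?_ (tendsto_iff_norm_sub_tendsto_zero.1 hy)
    filter_upwards [Ioc_mem_nhdsGT one_pos] with ε hε
    exact (hR.firmlyNonexpansive_yosidaResolvent hε.1 hε.2).norm_apply_le _
  simpa [← map_add] using h.add (hR.tendsto_yosidaResolvent_apply hinj x)

theorem norm_exp_smul_yosida_apply_le (hR : FirmlyNonexpansive R) (h0 : 0 < ε) (h1 : ε ≤ 1)
    (x : X) {t : ℝ} (ht : 0 ≤ t) : ‖NormedSpace.exp (t • yosida R ε) x‖ ≤ ‖x‖ :=
  norm_exp_smul_apply_le (hR.inner_yosida_nonpos h0 h1) x ht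

theorem uniformCauchySeqOn_exp_smul_yosida (hR : FirmlyNonexpansive R)
    (hinj : Function.Injective R) (x : X) (T : ℝ) :
    UniformCauchySeqOn (fun ε (t : ℝ) => NormedSpace.exp (t • yosida R ε) x) (𝓝[>] 0)
      (Icc 0 T) := by
  rw [uniformCauchySeqOn_iff_uniformCauchySeqOnFilter]
  suffices h : Tendsto (fun p : (ℝ × ℝ) × ℝ => (NormedSpace.exp (p.2 • yosida R p.1.1)
      - NormedSpace.exp (p.2 • yosida R p.1.2)) x) ((𝓝[>] 0 ×ˢ 𝓝[>] 0) ×ˢ 𝓟 (Icc 0 T)) (𝓝 0) by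
    rw [UniformCauchySeqOnFilter, uniformity_eq_comap_nhds_zero_swapped]
    rintro s ⟨U, hU, hUs⟩
    filter_upwards [h hU] with p hp using hUs hp
  have hsmall : ∀ᶠ p : (ℝ × ℝ) × ℝ in (𝓝[>] 0 ×ˢ 𝓝[>] 0) ×ˢ 𝓟 (Icc 0 T),
      (p.1.1 ∈ Ioc (0 : ℝ) 1 ∧ p.1.2 ∈ Ioc (0 : ℝ) 1) ∧ p.2 ∈ Icc 0 T :=
    prod_mem_prod (prod_mem_prod (Ioc_mem_nhdsGT one_pos) (Ioc_mem_nhdsGT one_pos))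
      (mem_principal_self _)
  refine tendsto_zero_of_denseRange (C := 2) ?_ (hR.denseRange hinj) (fun w => ?_) x
  · filter_upwards [hsmall] with p ⟨⟨h, h'⟩, ht⟩ x
    rw [sub_apply, two_mul]
    exact norm_sub_le_of_le (hR.norm_exp_smul_yosida_apply_le h.1 h.2 x ht.1)
      (hR.norm_exp_smul_yosida_apply_le h'.1 h'.2 x ht.1)
  · have hyos : Tendsto (fun ε => yosida R ε (R w)) (𝓝[>] 0) (𝓝 (R w - w)) := by
      simpa only [yosida_apply_apply] using hR.tendsto_yosidaResolvent_apply hinj (R w - w)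
    have hlim : Tendsto (fun p : (ℝ × ℝ) × ℝ =>
        T * ‖yosida R p.1.1 (R w) - yosida R p.1.2 (R w)‖)
        ((𝓝[>] 0 ×ˢ 𝓝[>] 0) ×ˢ 𝓟 (Icc 0 T)) (𝓝 0) := by
      simpa using ((((hyos.comp tendsto_fst).sub (hyos.comp tendsto_snd)).comp
        tendsto_fst).norm.const_mul T)
    refine squeeze_zero_norm' ?_ hlim
    filter_upwards [hsmall] with p ⟨⟨h, h'⟩, ht⟩
    refine (norm_exp_smul_sub_exp_smul_apply_le (hR.inner_yosida_nonpos h.1 h.2)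
      (hR.inner_yosida_nonpos h'.1 h'.2) (commute_yosida_yosida R _ _) _ ht.1).trans ?_
    gcongr
    exact ht.2

theorem apply_exp_smul_yosida_eq_integral (R : X →L[ℝ] X) (ε : ℝ) (x : X) (t : ℝ) :
    R (NormedSpace.exp (t • yosida R ε) x) = R x + ∫ s in (0 : ℝ)..t, yosidaResolvent R ε
      (R (NormedSpace.exp (s • yosida R ε) x) - NormedSpace.exp (s • yosida R ε) x) := by
  have hderiv : ∀ s, HasDerivAt (fun s : ℝ => R (NormedSpace.exp (s • yosida R ε) x))
      (yosidaResolvent R ε (R (NormedSpace.exp (s • yosida R ε) x)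
        - NormedSpace.exp (s • yosida R ε) x)) s := fun s => by
    rw [← apply_yosida]
    exact R.hasFDerivAt.comp_hasDerivAt s (hasDerivAt_exp_smul_apply _ x s)
  rw [intervalIntegral.integral_eq_sub_of_hasDerivAt (fun s _ => hderiv s)]
  · simp
  · have := continuous_exp_smul_apply (yosida R ε) x
    exact Continuous.intervalIntegrable (by fun_prop) _ _

theorem exists_tendstoUniformlyOn_exp_smul_yosida (hR : FirmlyNonexpansive R)
    (hinj : Function.Injective R) (x : X) :
    ∃ u : ℝ → X, ∀ T, TendstoUniformlyOn
      (fun ε (t : ℝ) => NormedSpace.exp (t • yosida R ε) x) u (𝓝[>] 0) (Icc 0 T) := by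
  have hlim : ∀ t : ℝ, ∃ v, 0 ≤ t →
      Tendsto (fun ε => NormedSpace.exp (t • yosida R ε) x) (𝓝[>] 0) (𝓝 v) := by
    intro t
    rcases le_or_gt 0 t with ht | ht
    · have hc := (hR.uniformCauchySeqOn_exp_smul_yosida hinj x t).cauchy_map ⟨ht, le_rfl⟩
      exact (cauchy_map_iff_exists_tendsto.1 hc).imp fun v hv _ => hv
    · exact ⟨0, fun h => absurd h ht.not_ge⟩
  choose u hu using hlim
  exact ⟨u, fun T => (hR.uniformCauchySeqOn_exp_smul_yosida hinj x T).tendstoUniformlyOn_of_tendsto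
    fun t ht => hu t ht.1⟩

theorem tendsto_integral_yosidaResolvent (hR : FirmlyNonexpansive R)
    (hinj : Function.Injective R) {x : X} {u : ℝ → X}
    (hu : ∀ t, 0 ≤ t → Tendsto (fun ε => NormedSpace.exp (t • yosida R ε) x) (𝓝[>] 0) (𝓝 (u t)))
    {t : ℝ} (ht : 0 ≤ t) :
    Tendsto (fun ε => ∫ s in (0 : ℝ)..t, yosidaResolvent R ε
        (R (NormedSpace.exp (s • yosida R ε) x) - NormedSpace.exp (s • yosida R ε) x)) (𝓝[>] 0)
      (𝓝 (∫ s in (0 : ℝ)..t, (R (u s) - u s))) := by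
  refine intervalIntegral.tendsto_integral_filter_of_dominated_convergence
    (fun _ => 2 * ‖x‖) (Eventually.of_forall fun ε => ?_) ?_ intervalIntegrable_const
    (Eventually.of_forall fun s hs => ?_)
  · have := continuous_exp_smul_apply (yosida R ε) x
    exact Continuous.aestronglyMeasurable (by fun_prop)
  · filter_upwards [Ioc_mem_nhdsGT one_pos] with ε hε
    refine Eventually.of_forall fun s hs => ?_
    rw [uIoc_of_le ht] at hs
    have hexp := hR.norm_exp_smul_yosida_apply_le hε.1 hε.2 x hs.1.le
    calc _ ≤ _ := (hR.firmlyNonexpansive_yosidaResolvent hε.1 hε.2).norm_apply_le _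
      _ ≤ _ := norm_sub_le _ _
      _ ≤ 2 * ‖x‖ := by linarith [hR.norm_apply_le (NormedSpace.exp (s • yosida R ε) x)]
  · rw [uIoc_of_le ht] at hs
    have hs' := hu s hs.1.le
    exact hR.tendsto_yosidaResolvent_apply_of_tendsto hinj
      (((R.continuous.tendsto _).comp hs').sub hs')

theorem exists_hasDerivWithinAt_resolvent (hR : FirmlyNonexpansive R)
    (hinj : Function.Injective R) (x : X) :
    ∃ u : ℝ → X, ContinuousOn u (Ici 0) ∧ u 0 = x ∧
      ∀ t, 0 ≤ t → HasDerivWithinAt (fun s => R (u s)) (R (u t) - u t) (Ici 0) t := by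
  obtain ⟨u, hunif⟩ := hR.exists_tendstoUniformlyOn_exp_smul_yosida hinj x
  have hu : ∀ t, 0 ≤ t → Tendsto (fun ε => NormedSpace.exp (t • yosida R ε) x) (𝓝[>] 0)
      (𝓝 (u t)) := fun t ht => (hunif t).tendsto_at ⟨ht, le_rfl⟩
  have hcont : ContinuousOn u (Ici 0) := by
    intro t ht
    have hc : ContinuousOn u (Icc 0 (t + 1)) := (hunif (t + 1)).continuousOn
      (Frequently.of_forall fun ε => (continuous_exp_smul_apply _ x).continuousOn)
    refine (hc t ⟨ht, by linarith⟩).mono_of_mem_nhdsWithin ?_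
    rw [← Ici_inter_Iic]
    exact inter_mem_nhdsWithin _ (Iic_mem_nhds (by linarith))
  have h0 : u 0 = x := tendsto_nhds_unique (hu 0 le_rfl) (by simp)
  refine ⟨u, hcont, h0, fun t ht => ?_⟩
  have hintegral : ∀ t ∈ Ici (0 : ℝ), R (u t) = R x + ∫ s in (0 : ℝ)..t, (R (u s) - u s) := by
    intro t ht
    refine tendsto_nhds_unique ((R.continuous.tendsto _).comp (hu t ht)) ?_
    simp only [Function.comp_def, apply_exp_smul_yosida_eq_integral R _ x t]
    exact (hR.tendsto_integral_yosidaResolvent hinj hu ht).const_add _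
  exact ((hasDerivWithinAt_integral_Ici ((R.continuous.comp_continuousOn hcont).sub hcont)
    ht).const_add (R x)).congr hintegral (hintegral t ht)

theorem exists_hasDerivWithinAt_resolvent_shift (hR : FirmlyNonexpansive R)
    (hinj : Function.Injective R) (μ : ℝ) (x : X) :
    ∃ u : ℝ → X, ContinuousOn u (Ici 0) ∧ u 0 = x ∧
      ∀ t, 0 ≤ t → HasDerivWithinAt (fun s => R (u s)) (μ • R (u t) - u t) (Ici 0) t := by
  obtain ⟨u, hcont, h0, hu⟩ := hR.exists_hasDerivWithinAt_resolvent hinj x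
  refine ⟨fun t => Real.exp ((μ - 1) * t) • u t, ContinuousOn.smul (by fun_prop) hcont,
    by simp [h0], fun t ht => ?_⟩
  have hexp : HasDerivAt (fun t => Real.exp ((μ - 1) * t))
      (Real.exp ((μ - 1) * t) * (μ - 1)) t := by
    simpa using ((hasDerivAt_id t).const_mul (μ - 1)).exp
  simp only [map_smul]
  refine (hexp.hasDerivWithinAt.smul (hu t ht)).congr_deriv ?_
  module

end FirmlyNonexpansive

end Generation

section WaveEquation

variable {W H : Type*} [NormedAddCommGroup W] [NormedSpace ℝ W]
  [NormedAddCommGroup H] [InnerProductSpace ℝ H]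

/-- `u : [0, ∞) → W` with velocity `v : [0, ∞) → H` is a weak solution of the abstract wave
equation `d/dt ⟪v, ι φ⟫ + a(u, φ) = 0`, where `W` is the form domain of `a`, mapped to the state
space `H` by `ι`. Only the values at `t ≥ 0` matter. -/
structure IsWaveSolution (ι : W →L[ℝ] H) (a : W →L[ℝ] W →L[ℝ] ℝ) (u : ℝ → W) (v : ℝ → H) :
    Prop where
  continuousOn : ContinuousOn u (Ici 0)
  continuousOn_velocity : ContinuousOn v (Ici 0)
  hasDerivWithinAt : ∀ t, 0 ≤ t → HasDerivWithinAt (fun s => ι (u s)) (v t) (Ici 0) t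
  hasDerivWithinAt_inner_velocity : ∀ φ t, 0 ≤ t →
    HasDerivWithinAt (fun s => ⟪v s, ι φ⟫_ℝ) (-a (u t) φ) (Ici 0) t

namespace IsWaveSolution

variable {ι : W →L[ℝ] H} {a : W →L[ℝ] W →L[ℝ] ℝ} {u u' : ℝ → W} {v v' : ℝ → H} {t : ℝ}

theorem sub (hu : IsWaveSolution ι a u v) (hu' : IsWaveSolution ι a u' v') :
    IsWaveSolution ι a (fun t => u t - u' t) (fun t => v t - v' t) where
  continuousOn := hu.continuousOn.sub hu'.continuousOn
  continuousOn_velocity := hu.continuousOn_velocity.sub hu'.continuousOn_velocity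
  hasDerivWithinAt t ht := by
    simp only [map_sub]
    exact (hu.hasDerivWithinAt t ht).sub (hu'.hasDerivWithinAt t ht)
  hasDerivWithinAt_inner_velocity φ t ht := by
    simp only [inner_sub_left]
    refine ((hu.hasDerivWithinAt_inner_velocity φ t ht).sub
      (hu'.hasDerivWithinAt_inner_velocity φ t ht)).congr_deriv ?_
    rw [map_sub, sub_apply]
    ring

theorem map {W' : Type*} [NormedAddCommGroup W'] [NormedSpace ℝ W'] {ι' : W' →L[ℝ] H}
    {a' : W' →L[ℝ] W' →L[ℝ] ℝ} (hu : IsWaveSolution ι a u v) {e : W →L[ℝ] W'}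
    (he : Function.Surjective e) (hι : ∀ x, ι' (e x) = ι x)
    (ha : ∀ x y, a' (e x) (e y) = a x y) : IsWaveSolution ι' a' (fun t => e (u t)) v where
  continuousOn := e.continuous.comp_continuousOn hu.continuousOn
  continuousOn_velocity := hu.continuousOn_velocity
  hasDerivWithinAt := by simpa only [hι] using hu.hasDerivWithinAt
  hasDerivWithinAt_inner_velocity := by
    refine he.forall.2 fun φ => ?_
    simpa only [hι, ha] using hu.hasDerivWithinAt_inner_velocity φ

variable [CompleteSpace W]

theorem inner_velocity_add_integral (hu : IsWaveSolution ι a u v) (φ : W) (ht : 0 ≤ t) :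
    ⟪v t, ι φ⟫_ℝ + a (∫ s in (0 : ℝ)..t, u s) φ = ⟪v 0, ι φ⟫_ℝ := by
  have hconst := eq_of_hasDerivWithinAt_Ici_zero
    (F := fun t => ⟪v t, ι φ⟫_ℝ + a.flip φ (∫ s in (0 : ℝ)..t, u s)) (fun t ht => by
      have hprim := (a.flip φ).hasFDerivAt.comp_hasDerivWithinAt t
        (hasDerivWithinAt_integral_Ici hu.continuousOn ht)
      exact ((hu.hasDerivWithinAt_inner_velocity φ t ht).add hprim).congr_deriv (neg_add_cancel _))
    ht
  simpa using hconst

/-- Conservation of energy for the time primitive `∫₀ᵗ u` of `u`, which solves the wave equation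
with constant forcing `v 0`. -/
theorem norm_sq_add_integral (hu : IsWaveSolution ι a u v) (ha : ∀ x y, a x y = a y x)
    (ht : 0 ≤ t) :
    ‖ι (u t)‖ ^ 2 + a (∫ s in (0 : ℝ)..t, u s) (∫ s in (0 : ℝ)..t, u s)
      = ‖ι (u 0)‖ ^ 2 + 2 * ⟪v 0, ι (∫ s in (0 : ℝ)..t, u s)⟫_ℝ := by
  have hconst := eq_of_hasDerivWithinAt_Ici_zero
    (F := fun t => ‖ι (u t)‖ ^ 2 + a (∫ s in (0 : ℝ)..t, u s) (∫ s in (0 : ℝ)..t, u s)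
      - 2 * ⟪v 0, ι (∫ s in (0 : ℝ)..t, u s)⟫_ℝ) (fun t ht => by
      have hU := hasDerivWithinAt_integral_Ici hu.continuousOn ht
      have hform := (a.hasFDerivAt.comp_hasDerivWithinAt t hU).clm_apply hU
      have hinner := (hasDerivWithinAt_const t (Ici 0) (v 0)).inner ℝ
        (ι.hasFDerivAt.comp_hasDerivWithinAt t hU)
      refine (((hu.hasDerivWithinAt t ht).norm_sq.add hform).sub
        (hinner.const_mul 2)).congr_deriv ?_
      have htest := hu.inner_velocity_add_integral (u t) ht
      rw [inner_zero_left, add_zero, Function.comp_apply, ha (u t), real_inner_comm, ← htest]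
      ring) ht
  simp only [intervalIntegral.integral_same, map_zero, inner_zero_right] at hconst
  linarith

theorem norm_sq_le (hu : IsWaveSolution ι a u v) (ha : ∀ x y, a x y = a y x) {K : ℝ}
    (hK : ∀ w, 2 * ⟪v 0, ι w⟫_ℝ ≤ K + a w w) (ht : 0 ≤ t) : ‖ι (u t)‖ ^ 2 ≤ ‖ι (u 0)‖ ^ 2 + K := by
  linarith [hu.norm_sq_add_integral ha ht, hK (∫ s in (0 : ℝ)..t, u s)]

theorem eqOn (hu : IsWaveSolution ι a u v) (hu' : IsWaveSolution ι a u' v')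
    (ha : ∀ x y, a x y = a y x) (hpos : ∀ w, 0 ≤ a w w) (hι : Function.Injective ι)
    (h0 : u 0 = u' 0) (h0' : v 0 = v' 0) : EqOn u u' (Ici 0) := by
  intro t ht
  have h := (hu.sub hu').norm_sq_le ha (K := 0) (fun w => by simpa [h0'] using hpos w) ht
  rw [h0, sub_self, map_zero, norm_zero, zero_pow two_ne_zero, add_zero] at h
  exact sub_eq_zero.1 ((map_eq_zero_iff ι hι).1 (norm_eq_zero.1
    (pow_eq_zero_iff two_ne_zero |>.1 (le_antisymm h (sq_nonneg _)))))

end IsWaveSolution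

end WaveEquation

section EnergyForm

variable {W H K : Type*} [NormedAddCommGroup W] [NormedSpace ℝ W] [NormedAddCommGroup H]
  [InnerProductSpace ℝ H] [NormedAddCommGroup K] [InnerProductSpace ℝ K]

/-- The bounded bilinear form `⟪L x, L y⟫ + ⟪M (P x), P y⟫` on `W`: a principal part given by `L`
and a lower order part given by a bounded operator `M` on the state space. -/
noncomputable def energyForm (P : W →L[ℝ] H) (L : W →L[ℝ] K) (M : H →L[ℝ] H) : W →L[ℝ] W →L[ℝ] ℝ :=
  (innerSL ℝ).bilinearComp L L + (innerSL ℝ).bilinearComp (M ∘L P) P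

theorem energyForm_apply (P : W →L[ℝ] H) (L : W →L[ℝ] K) (M : H →L[ℝ] H) (x y : W) :
    energyForm P L M x y = ⟪L x, L y⟫_ℝ + ⟪M (P x), P y⟫_ℝ := rfl

/-- The map `w ↦ (P w, L w)` into the Hilbert sum, which turns the form domain `W` into a Hilbert
space with the graph norm. -/
noncomputable def graphEmbedding (P : W →L[ℝ] H) (L : W →L[ℝ] K) : W →L[ℝ] WithLp 2 (H × K) :=
  ((WithLp.prodContinuousLinearEquiv 2 ℝ H K).symm : H × K →L[ℝ] WithLp 2 (H × K)) ∘L P.prod L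

theorem isClosed_range_graphEmbedding [CompleteSpace W] {P : W →L[ℝ] H} {L : W →L[ℝ] K} {c : ℝ}
    (hc : ∀ w, ‖w‖ ≤ c * (‖P w‖ + ‖L w‖)) : IsClosed (range (graphEmbedding P L)) := by
  refine (AddMonoidHomClass.antilipschitz_of_bound (graphEmbedding P L)
    (K := (2 * |c|).toNNReal) fun w => ?_).isClosed_range (graphEmbedding P L).uniformContinuous
  calc ‖w‖ ≤ |c| * (‖P w‖ + ‖L w‖) := (hc w).trans (by gcongr; exact le_abs_self c)
    _ ≤ |c| * (‖graphEmbedding P L w‖ + ‖graphEmbedding P L w‖) := by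
        gcongr
        · exact WithLp.norm_fst_le _ (graphEmbedding P L w)
        · exact WithLp.norm_snd_le _ (graphEmbedding P L w)
    _ = (2 * |c|).toNNReal * ‖graphEmbedding P L w‖ := by
        rw [Real.coe_toNNReal _ (by positivity)]
        ring

end EnergyForm

section WaveExistence

/-- `R` is the resolvent `(μ - A)⁻¹` of the generator `A (u, v) = (v, -a(u, ·))` of the first-order
system associated with the wave equation of the form `a`, in weak form. -/
structure IsWaveResolvent {W H : Type*} [NormedAddCommGroup W] [InnerProductSpace ℝ W]
    [NormedAddCommGroup H] [InnerProductSpace ℝ H] (ι : W →L[ℝ] H) (a : W →L[ℝ] W →L[ℝ] ℝ) (μ : ℝ)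
    (R : WithLp 2 (W × H) →L[ℝ] WithLp 2 (W × H)) : Prop where
  snd_eq : ∀ x, (R x).snd = ι (μ • (R x).fst - x.fst)
  inner_snd : ∀ x φ, ⟪μ • (R x).snd - x.snd, ι φ⟫_ℝ = -a (R x).fst φ

variable {W H : Type*} [NormedAddCommGroup W] [InnerProductSpace ℝ W]
  [NormedAddCommGroup H] [InnerProductSpace ℝ H] {ι : W →L[ℝ] H}

namespace IsWaveResolvent

variable {a : W →L[ℝ] W →L[ℝ] ℝ} {M : H →L[ℝ] H} {μ : ℝ}
  {R : WithLp 2 (W × H) →L[ℝ] WithLp 2 (W × H)}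

theorem injective (hR : IsWaveResolvent ι a μ R) (hι : Function.Injective ι)
    (hdense : DenseRange ι) : Function.Injective R := by
  refine (injective_iff_map_eq_zero R).2 fun x hx => ?_
  have hfst : x.fst = 0 := by
    have h := hR.snd_eq x
    rw [hx, WithLp.zero_snd, WithLp.zero_fst, smul_zero, zero_sub, map_neg, eq_comm,
      neg_eq_zero] at h
    exact (map_eq_zero_iff ι hι).1 h
  have hsnd : x.snd = 0 := by
    refine hdense.eq_zero_of_inner_left ℝ fun φ => ?_
    simpa [hx] using hR.inner_snd x φ
  exact (WithLp.equiv 2 (W × H)).injective (Prod.ext hfst hsnd)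

theorem firmlyNonexpansive (hR : IsWaveResolvent ι (energyForm ι (.id ℝ W) M) μ R)
    (hμ : 1 + ‖M‖ * ‖ι‖ ≤ μ) : FirmlyNonexpansive R := by
  intro x
  have htest : ⟪x, R x⟫_ℝ = μ * ‖R x‖ ^ 2 + ⟪M (ι (R x).fst), (R x).snd⟫_ℝ := by
    have h := hR.inner_snd x (μ • (R x).fst - x.fst)
    rw [energyForm_apply, ← hR.snd_eq, ContinuousLinearMap.id_apply,
      ContinuousLinearMap.id_apply, inner_sub_left, real_inner_smul_left, inner_sub_right,
      real_inner_smul_right, real_inner_self_eq_norm_sq, real_inner_self_eq_norm_sq] at h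
    have hinner : ⟪x, R x⟫_ℝ = ⟪(R x).fst, x.fst⟫_ℝ + ⟪x.snd, (R x).snd⟫_ℝ := by
      rw [real_inner_comm x.fst]
      exact WithLp.prod_inner_apply x (R x)
    rw [hinner, WithLp.prod_norm_sq_eq_of_L2]
    linarith
  have hM : -(‖M‖ * ‖ι‖ * ‖R x‖ ^ 2) ≤ ⟪M (ι (R x).fst), (R x).snd⟫_ℝ := by
    refine (abs_le.1 ((abs_real_inner_le_norm _ _).trans ?_)).1
    calc ‖M (ι (R x).fst)‖ * ‖(R x).snd‖
        ≤ (‖M‖ * (‖ι‖ * ‖(R x).fst‖)) * ‖(R x).snd‖ := by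
          gcongr
          exact M.le_opNorm_of_le (ι.le_opNorm _)
      _ ≤ (‖M‖ * (‖ι‖ * ‖R x‖)) * ‖R x‖ := by
          gcongr
          · exact WithLp.norm_fst_le _ (R x)
          · exact WithLp.norm_snd_le _ (R x)
      _ = ‖M‖ * ‖ι‖ * ‖R x‖ ^ 2 := by ring
  rw [htest]
  nlinarith [mul_le_mul_of_nonneg_right hμ (sq_nonneg ‖R x‖)]

theorem isWaveSolution (hR : IsWaveResolvent ι a μ R) {x : ℝ → WithLp 2 (W × H)}
    (hx : ContinuousOn x (Ici 0))
    (hderiv : ∀ t, 0 ≤ t → HasDerivWithinAt (fun s => R (x s)) (μ • R (x t) - x t) (Ici 0) t) :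
    IsWaveSolution ι a (fun t => (x t).fst) (fun t => (x t).snd) := by
  have hfst : ∀ t, 0 ≤ t → HasDerivWithinAt (fun s => (R (x s)).fst)
      (μ • (R (x t)).fst - (x t).fst) (Ici 0) t := fun t ht =>
    (WithLp.fstL 2 ℝ W H).hasFDerivAt.comp_hasDerivWithinAt t (hderiv t ht)
  have hsnd : ∀ t, 0 ≤ t → HasDerivWithinAt (fun s => (R (x s)).snd)
      (μ • (R (x t)).snd - (x t).snd) (Ici 0) t := fun t ht =>
    (WithLp.sndL 2 ℝ W H).hasFDerivAt.comp_hasDerivWithinAt t (hderiv t ht)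
  have hι : ∀ s, ι (x s).fst = μ • ι (R (x s)).fst - (R (x s)).snd := fun s => by
    rw [hR.snd_eq, map_sub, map_smul, sub_sub_cancel]
  have hv : ∀ s φ, ⟪(x s).snd, ι φ⟫_ℝ = μ * ⟪(R (x s)).snd, ι φ⟫_ℝ + a.flip φ (R (x s)).fst := by
    intro s φ
    have h := hR.inner_snd (x s) φ
    rw [inner_sub_left, real_inner_smul_left] at h
    rw [ContinuousLinearMap.flip_apply]
    linarith
  refine ⟨(WithLp.fstL 2 ℝ W H).continuous.comp_continuousOn hx,
    (WithLp.sndL 2 ℝ W H).continuous.comp_continuousOn hx, fun t ht => ?_, fun φ t ht => ?_⟩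
  · simp only [hι]
    refine (((ι.hasFDerivAt.comp_hasDerivWithinAt t (hfst t ht)).const_smul μ).sub
      (hsnd t ht)).congr_deriv ?_
    rw [← hR.snd_eq, sub_sub_cancel]
  · simp only [hv]
    refine ((((hsnd t ht).inner ℝ (hasDerivWithinAt_const t _ (ι φ))).const_mul μ).add
      ((a.flip φ).hasFDerivAt.comp_hasDerivWithinAt t (hfst t ht))).congr_deriv ?_
    rw [inner_zero_right, zero_add, hR.inner_snd, map_sub, map_smul,
      ContinuousLinearMap.flip_apply, ContinuousLinearMap.flip_apply, smul_eq_mul]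
    ring

end IsWaveResolvent

variable [CompleteSpace W] [CompleteSpace H]

theorem exists_stationary_solution (ι : W →L[ℝ] H) {M : H →L[ℝ] H} {c : ℝ} (hc : ‖M‖ ≤ c) :
    ∃ S : H →L[ℝ] W, ∀ g φ,
      c * ⟪ι (S g), ι φ⟫_ℝ + energyForm ι (.id ℝ W) M (S g) φ = ⟪g, ι φ⟫_ℝ := by
  set A : W →L[ℝ] W := c • (ι.adjoint ∘L ι) + 1 + ι.adjoint ∘L M ∘L ι
  have hA : ∀ u φ, ⟪A u, φ⟫_ℝ = c * ⟪ι u, ι φ⟫_ℝ + energyForm ι (.id ℝ W) M u φ := by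
    intro u φ
    simp only [A, energyForm_apply, add_apply, smul_apply, ContinuousLinearMap.comp_apply,
      inner_add_left, real_inner_smul_left, ContinuousLinearMap.adjoint_inner_left,
      one_apply_eq_self, ContinuousLinearMap.id_apply, add_assoc]
  have hunit : IsUnit A := by
    refine ContinuousLinearMap.isUnit_of_forall_le_norm_inner_map A one_pos fun u => ?_
    refine le_trans ?_ (le_abs_self _)
    have hM := (abs_le.1 ((abs_real_inner_le_norm (M (ι u)) (ι u)).trans
      (mul_le_mul_of_nonneg_right (M.le_of_opNorm_le hc (ι u)) (norm_nonneg _)))).1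
    rw [hA, energyForm_apply, ContinuousLinearMap.id_apply, real_inner_self_eq_norm_sq,
      real_inner_self_eq_norm_sq, NNReal.coe_one]
    linarith
  refine ⟨Ring.inverse A ∘L ι.adjoint, fun g φ => ?_⟩
  have hinv : A (Ring.inverse A (ι.adjoint g)) = ι.adjoint g :=
    congrArg (· (ι.adjoint g)) (Ring.mul_inverse_cancel A hunit)
  rw [← hA, ContinuousLinearMap.comp_apply, hinv, ContinuousLinearMap.adjoint_inner_left]

theorem exists_isWaveResolvent (ι : W →L[ℝ] H) {M : H →L[ℝ] H} {μ : ℝ} (hμ : ‖M‖ ≤ μ ^ 2) :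
    ∃ R, IsWaveResolvent ι (energyForm ι (.id ℝ W) M) μ R := by
  obtain ⟨S, hS⟩ := exists_stationary_solution ι hμ
  set U : WithLp 2 (W × H) →L[ℝ] W :=
    S ∘L (WithLp.sndL 2 ℝ W H + μ • (ι ∘L WithLp.fstL 2 ℝ W H))
  refine ⟨((WithLp.prodContinuousLinearEquiv 2 ℝ W H).symm : W × H →L[ℝ] WithLp 2 (W × H)) ∘L
    (U.prod (ι ∘L (μ • U - WithLp.fstL 2 ℝ W H))), fun x => rfl, fun x φ => ?_⟩
  change ⟪μ • ι (μ • U x - x.fst) - x.snd, ι φ⟫_ℝ = -energyForm ι (.id ℝ W) M (U x) φ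
  have h : μ ^ 2 * ⟪ι (U x), ι φ⟫_ℝ + energyForm ι (.id ℝ W) M (U x) φ
      = ⟪x.snd + μ • ι x.fst, ι φ⟫_ℝ := hS _ φ
  rw [inner_add_left, real_inner_smul_left] at h
  rw [map_sub, map_smul, inner_sub_left, real_inner_smul_left, inner_sub_left,
    real_inner_smul_left]
  linarith

theorem exists_isWaveSolution_of_hilbert (hι : Function.Injective ι) (hdense : DenseRange ι)
    (M : H →L[ℝ] H) (u₀ : W) (u₁ : H) :
    ∃ u v, IsWaveSolution ι (energyForm ι (.id ℝ W) M) u v ∧ u 0 = u₀ ∧ v 0 = u₁ := by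
  obtain ⟨μ, hμ, hMμ⟩ : ∃ μ : ℝ, 1 + ‖M‖ * ‖ι‖ ≤ μ ∧ ‖M‖ ≤ μ ^ 2 := by
    have := mul_nonneg (norm_nonneg M) (norm_nonneg ι)
    refine ⟨1 + ‖M‖ + ‖M‖ * ‖ι‖, ?_, ?_⟩ <;> nlinarith [norm_nonneg M]
  obtain ⟨R, hR⟩ := exists_isWaveResolvent ι hMμ
  obtain ⟨x, hx, hx0, hderiv⟩ := (hR.firmlyNonexpansive hμ).exists_hasDerivWithinAt_resolvent_shift
    (hR.injective hι hdense) μ (WithLp.toLp 2 (u₀, u₁))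
  exact ⟨_, _, hR.isWaveSolution hx hderiv, congrArg WithLp.fst hx0, congrArg WithLp.snd hx0⟩

theorem exists_isWaveSolution {W K : Type*} [NormedAddCommGroup W] [NormedSpace ℝ W]
    [CompleteSpace W] [NormedAddCommGroup K] [InnerProductSpace ℝ K] [CompleteSpace K]
    {P : W →L[ℝ] H} {L : W →L[ℝ] K} (hP : Function.Injective P) (hdense : DenseRange P) {c : ℝ}
    (hc : ∀ w, ‖w‖ ≤ c * (‖P w‖ + ‖L w‖)) (M : H →L[ℝ] H) (u₀ : W) (u₁ : H) :
    ∃ u v, IsWaveSolution P (energyForm P L M) u v ∧ u 0 = u₀ ∧ v 0 = u₁ := by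
  set j : W →L[ℝ] WithLp 2 (H × K) := graphEmbedding P L
  have hj : Function.Injective j := fun x y h => hP (congrArg WithLp.fst h)
  have hclosed : IsClosed (range j) := isClosed_range_graphEmbedding hc
  have : CompleteSpace j.range := hclosed.completeSpace_coe
  set e : W ≃L[ℝ] j.range := j.equivRange hj hclosed
  set ι : j.range →L[ℝ] H := WithLp.fstL 2 ℝ H K ∘L j.range.subtypeL
  have hι : ∀ x, P (e.symm x) = ι x :=
    e.surjective.forall.2 fun w => congrArg P (e.symm_apply_apply w)
  have hιinj : Function.Injective ι := fun x y h =>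
    e.symm.injective (hP ((hι x).trans (h.trans (hι y).symm)))
  have hιdense : DenseRange ι := by
    have : ι ∘ e = P := rfl
    exact DenseRange.of_comp (g := e) (this ▸ hdense)
  have hform : ∀ x y, energyForm P L M (e.symm x) (e.symm y)
      = energyForm ι (.id ℝ j.range) (M - 1) x y := by
    refine e.surjective.forall₂.2 fun w z => ?_
    have hinner : ⟪e w, e z⟫_ℝ = ⟪P w, P z⟫_ℝ + ⟪L w, L z⟫_ℝ := rfl
    rw [e.symm_apply_apply, e.symm_apply_apply, energyForm_apply, energyForm_apply,
      ContinuousLinearMap.id_apply, ContinuousLinearMap.id_apply, hinner, sub_apply,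
      inner_sub_left]
    change _ = _ + (⟪M (P w), P z⟫_ℝ - ⟪P w, P z⟫_ℝ)
    ring
  obtain ⟨u, v, huv, hu, hv⟩ := exists_isWaveSolution_of_hilbert hιinj hιdense (M - 1) (e u₀) u₁
  exact ⟨_, v, huv.map (e := (e.symm : j.range →L[ℝ] W)) e.symm.surjective hι hform,
    (congrArg e.symm hu).trans (e.symm_apply_apply u₀), hv⟩

end WaveExistence

section Translation

open scoped ENNReal

variable {G E : Type*} [AddGroup G] [MeasurableSpace G] [MeasurableAdd G] {μ : Measure G}
  [μ.IsAddRightInvariant] [NormedAddCommGroup E] [NormedSpace ℝ E] {p : ℝ≥0∞} [Fact (1 ≤ p)]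

/-- The translation `f ↦ f (· + v)` of `Lᵖ` functions. -/
noncomputable def translation (v : G) : Lp E p μ →ₗᵢ[ℝ] Lp E p μ :=
  Lp.compMeasurePreservingₗᵢ ℝ (· + v) (measurePreserving_add_right μ v)

theorem coeFn_translation (v : G) (f : Lp E p μ) : translation v f =ᵐ[μ] fun x => f (x + v) :=
  Lp.coeFn_compMeasurePreserving f (measurePreserving_add_right μ v)

theorem translation_zero (f : Lp E p μ) : translation 0 f = f := by
  refine Lp.ext ?_
  filter_upwards [coeFn_translation 0 f] with x hx
  rw [hx, add_zero]

theorem translation_add (v w : G) (f : Lp E p μ) :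
    translation (v + w) f = translation v (translation w f) := by
  refine Lp.ext ?_
  filter_upwards [coeFn_translation (v + w) f, coeFn_translation v (translation w f),
    (measurePreserving_add_right μ v).quasiMeasurePreserving.ae (coeFn_translation w f)]
    with x h₁ h₂ h₃
  rw [h₁, h₂, h₃, add_assoc]

theorem inner_translation_left (v : G) (f g : Lp ℝ 2 μ) :
    ⟪translation v f, g⟫_ℝ = ⟪f, translation (-v) g⟫_ℝ := by
  rw [← (translation v).inner_map_map f, ← translation_add, add_neg_cancel, translation_zero]

theorem continuous_translation {G : Type*} [AddGroup G] [TopologicalSpace G]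
    [IsTopologicalAddGroup G] [MeasurableSpace G] [BorelSpace G] {μ : Measure G}
    [μ.IsAddRightInvariant] [μ.InnerRegularCompactLTTop] [IsLocallyFiniteMeasure μ]
    [MeasurableAdd G] (hp : p ≠ ⊤) (f : Lp E p μ) : Continuous fun v : G => translation v f := by
  have hadd : Continuous fun v : G => (⟨(· + v), by fun_prop⟩ : C(G, G)) :=
    ContinuousMap.continuous_of_continuous_uncurry _ (continuous_snd.add continuous_fst)
  exact (continuous_const (y := f)).compMeasurePreservingLp hadd
    (measurePreserving_add_right μ) hp

end Translation

theorem hasDerivAt_integral_mul_comp_sub_smul {E : Type*} [NormedAddCommGroup E] [NormedSpace ℝ E]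
    [MeasurableSpace E] [BorelSpace E] {μ : Measure E} [SFinite μ] [μ.IsAddLeftInvariant]
    {f ψ : E → ℝ} (hf : LocallyIntegrable f μ)
    (hψ : ContDiff ℝ 1 ψ) (hc : HasCompactSupport ψ) (e : E) (s : ℝ) :
    HasDerivAt (fun s : ℝ => ∫ x, f x * ψ (x - s • e) ∂μ)
      (-∫ x, f x * fderiv ℝ ψ (x - s • e) e ∂μ) s := by
  -- The integral is the convolution of `f` with the reflection of `ψ`, evaluated at `s • e`.
  set g : E → ℝ := fun x => ψ (-x)
  have hg : ContDiff ℝ 1 g := hψ.comp contDiff_neg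
  have hgc : HasCompactSupport g := hc.comp_homeomorph (Homeomorph.neg E)
  have hconv := (hgc.hasFDerivAt_convolution_right (ContinuousLinearMap.mul ℝ ℝ) hf hg
    (s • e)).comp_hasDerivAt s ((hasDerivAt_id s).smul_const e)
  rw [one_smul, convolution_precompR_apply _ hf (hgc.fderiv ℝ)
    (hg.continuous_fderiv one_ne_zero)] at hconv
  have hfderiv : ∀ x, fderiv ℝ g (s • e - x) e = -fderiv ℝ ψ (x - s • e) e := fun x => by
    have h := fderiv_comp_smul (f := ψ) (x := s • e - x) (-1 : ℝ)
    simp only [neg_one_smul, neg_sub] at h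
    rw [h, neg_apply]
  refine (hconv.congr_deriv ?_).congr_of_eventuallyEq (Eventually.of_forall fun r => ?_)
  · simp only [convolution_def, ContinuousLinearMap.mul_apply', hfderiv, mul_neg, integral_neg]
  · simp only [Function.comp_apply, convolution_def, ContinuousLinearMap.mul_apply', g, id, neg_sub]

section WeakDerivatives

variable {n : ℕ}

/-- The classical `i`-th partial derivative. -/
noncomputable def partialDeriv (i : Fin n) (ψ : Rn n → ℝ) (x : Rn n) : ℝ :=
  fderiv ℝ ψ x (EuclideanSpace.single i 1)

/-- The test functions on `ℝⁿ`: smooth and compactly supported. -/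
structure IsTest (ψ : Rn n → ℝ) : Prop where
  contDiff : ContDiff ℝ ∞ ψ
  hasCompactSupport : HasCompactSupport ψ

namespace IsTest

variable {ψ : Rn n → ℝ}

theorem differentiable (hψ : IsTest ψ) : Differentiable ℝ ψ :=
  hψ.contDiff.differentiable (by simp)

theorem partialDeriv (hψ : IsTest ψ) (i : Fin n) : IsTest (partialDeriv i ψ) where
  contDiff := (hψ.contDiff.fderiv_right (m := ∞) (by simp)).clm_apply contDiff_const
  hasCompactSupport := hψ.hasCompactSupport.fderiv_apply ℝ _

theorem partialDeriv_comm (hψ : IsTest ψ) (i j : Fin n) :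
    Plate.partialDeriv i (Plate.partialDeriv j ψ)
      = Plate.partialDeriv j (Plate.partialDeriv i ψ) := by
  have hsnd : ∀ (v w : Rn n) x,
      fderiv ℝ (fun y => fderiv ℝ ψ y v) x w = fderiv ℝ (fderiv ℝ ψ) x w v := by
    intro v w x
    have hd : DifferentiableAt ℝ (fderiv ℝ ψ) x :=
      (hψ.contDiff.fderiv_right (m := 1) (by norm_cast)).differentiable one_ne_zero x
    rw [fderiv_clm_apply hd (differentiableAt_const v)]
    simp
  ext x
  refine (hsnd _ _ x).trans (Eq.trans ?_ (hsnd _ _ x).symm)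
  refine hψ.contDiff.contDiffAt.isSymmSndFDerivAt ?_ _ _
  rw [minSmoothness_of_isRCLikeNormedField]
  norm_cast

theorem comp_sub_const (hψ : IsTest ψ) (v : Rn n) : IsTest fun x => ψ (x - v) where
  contDiff := hψ.contDiff.comp (contDiff_id.sub contDiff_const)
  hasCompactSupport := hψ.hasCompactSupport.comp_homeomorph (Homeomorph.subRight v)

theorem memLp (hψ : IsTest ψ) : MemLp ψ 2 (volume : Measure (Rn n)) :=
  hψ.contDiff.continuous.memLp_of_hasCompactSupport hψ.hasCompactSupport

/-- A test function as an element of `L²`. -/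
noncomputable def toL2 (hψ : IsTest ψ) : L2 n := hψ.memLp.toLp ψ

theorem coeFn_toL2 (hψ : IsTest ψ) : hψ.toL2 =ᵐ[volume] ψ := hψ.memLp.coeFn_toLp

theorem inner_toL2 (hψ : IsTest ψ) (f : L2 n) : ⟪f, hψ.toL2⟫_ℝ = ∫ x, f x * ψ x := by
  rw [L2.inner_def]
  refine integral_congr_ae ?_
  filter_upwards [hψ.coeFn_toL2] with x hx
  rw [hx, RCLike.inner_apply, conj_trivial, mul_comm]

theorem inner_translation_toL2 (hψ : IsTest ψ) (v : Rn n) (f : L2 n) :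
    ⟪translation v f, hψ.toL2⟫_ℝ = ⟪f, (hψ.comp_sub_const v).toL2⟫_ℝ := by
  rw [inner_toL2, inner_toL2, ← integral_add_right_eq_self (fun x => f x * ψ (x - v)) v]
  refine integral_congr_ae ?_
  filter_upwards [coeFn_translation v f] with x hx
  rw [hx, add_sub_cancel_right]

end IsTest

theorem ext_of_inner_test {f g : L2 n}
    (h : ∀ (ψ : Rn n → ℝ) (hψ : IsTest ψ), ⟪f, hψ.toL2⟫_ℝ = ⟪g, hψ.toL2⟫_ℝ) : f = g := by
  rw [← sub_eq_zero, Lp.eq_zero_iff_ae_eq_zero]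
  refine ae_eq_zero_of_integral_contDiff_smul_eq_zero
    ((Lp.memLp (f - g)).locallyIntegrable one_le_two) fun ψ hψ hc => ?_
  have hinner := IsTest.inner_toL2 ⟨hψ, hc⟩ (f - g)
  rw [inner_sub_left, h, sub_self] at hinner
  simpa only [smul_eq_mul, mul_comm] using hinner.symm

theorem hasWeakPartial_iff {i : Fin n} {f g : L2 n} : HasWeakPartial i f g ↔
    ∀ (ψ : Rn n → ℝ) (hψ : IsTest ψ), ⟪f, (hψ.partialDeriv i).toL2⟫_ℝ = -⟪g, hψ.toL2⟫_ℝ := by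
  simp only [IsTest.inner_toL2]
  exact ⟨fun h ψ hψ => h ψ hψ.contDiff hψ.hasCompactSupport, fun h ψ hψ hc => h ψ ⟨hψ, hc⟩⟩

theorem isClosed_hasWeakPartial (i : Fin n) :
    IsClosed {p : L2 n × L2 n | HasWeakPartial i p.1 p.2} := by
  simp only [hasWeakPartial_iff, Set.ofPred_forall]
  exact isClosed_iInter fun ψ => isClosed_iInter fun hψ =>
    isClosed_eq (continuous_fst.inner continuous_const) (continuous_snd.inner continuous_const).neg

theorem IsTest.hasWeakPartial {ψ : Rn n → ℝ} (hψ : IsTest ψ) (i : Fin n) :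
    HasWeakPartial i hψ.toL2 (hψ.partialDeriv i).toL2 := by
  refine hasWeakPartial_iff.2 fun φ hφ => ?_
  rw [real_inner_comm, real_inner_comm hφ.toL2, inner_toL2, inner_toL2]
  have hφψ : ∫ x, (hφ.partialDeriv i).toL2 x * ψ x = ∫ x, ψ x * Plate.partialDeriv i φ x := by
    refine integral_congr_ae ?_
    filter_upwards [(hφ.partialDeriv i).coeFn_toL2] with x hx
    rw [hx, mul_comm]
  have hψφ : ∫ x, hφ.toL2 x * Plate.partialDeriv i ψ x = ∫ x, Plate.partialDeriv i ψ x * φ x := by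
    refine integral_congr_ae ?_
    filter_upwards [hφ.coeFn_toL2] with x hx
    rw [hx, mul_comm]
  rw [hφψ, hψφ]
  exact integral_mul_fderiv_eq_neg_fderiv_mul_of_integrable
    ((hψ.partialDeriv i).memLp.integrable_mul hφ.memLp)
    (hψ.memLp.integrable_mul (hφ.partialDeriv i).memLp) (hψ.memLp.integrable_mul hφ.memLp)
    (fun x _ => hψ.differentiable x) (fun x _ => hφ.differentiable x)

namespace HasWeakPartial

variable {i j : Fin n} {f g f' g' : L2 n}

theorem unique (h : HasWeakPartial i f g) (h' : HasWeakPartial i f g') : g = g' :=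
  ext_of_inner_test fun ψ hψ => neg_injective <|
    (hasWeakPartial_iff.1 h ψ hψ).symm.trans (hasWeakPartial_iff.1 h' ψ hψ)

theorem partial_comm {fi fj fij fji : L2 n} (hi : HasWeakPartial i f fi)
    (hj : HasWeakPartial j f fj) (hij : HasWeakPartial j fi fij) (hji : HasWeakPartial i fj fji) :
    fij = fji :=
  ext_of_inner_test fun ψ hψ => by
    have hψij : ((hψ.partialDeriv j).partialDeriv i).toL2
        = ((hψ.partialDeriv i).partialDeriv j).toL2 := by
      congr 1
      exact hψ.partialDeriv_comm i j
    have h := hasWeakPartial_iff.1 hi _ (hψ.partialDeriv j)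
    rw [hψij, hasWeakPartial_iff.1 hj _ (hψ.partialDeriv i), hasWeakPartial_iff.1 hji _ hψ,
      hasWeakPartial_iff.1 hij _ hψ, neg_neg, neg_neg] at h
    exact h.symm

theorem translation (h : HasWeakPartial i f g) (v : Rn n) :
    HasWeakPartial i (translation v f) (translation v g) := by
  refine hasWeakPartial_iff.2 fun ψ hψ => ?_
  rw [IsTest.inner_translation_toL2, IsTest.inner_translation_toL2,
    ← hasWeakPartial_iff.1 h _ (hψ.comp_sub_const v)]
  congr 2
  ext x
  simp only [partialDeriv, sub_eq_add_neg, fderiv_comp_add_right]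

theorem hasDerivAt_inner_translation (h : HasWeakPartial i f g) {ψ : Rn n → ℝ} (hψ : IsTest ψ)
    (s : ℝ) : HasDerivAt
      (fun s : ℝ => ⟪Plate.translation (s • EuclideanSpace.single i 1) f, hψ.toL2⟫_ℝ)
      ⟪Plate.translation (s • EuclideanSpace.single i 1) g, hψ.toL2⟫_ℝ s := by
  have hderiv := hasDerivAt_integral_mul_comp_sub_smul
    ((Lp.memLp f).locallyIntegrable one_le_two) (hψ.contDiff.of_le (by norm_cast))
    hψ.hasCompactSupport (EuclideanSpace.single i 1) s
  simp only [hψ.inner_translation_toL2, IsTest.inner_toL2] at hderiv ⊢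
  refine hderiv.congr_deriv ?_
  have htest := h _ (hψ.comp_sub_const (s • EuclideanSpace.single i 1)).contDiff
    (hψ.comp_sub_const (s • EuclideanSpace.single i 1)).hasCompactSupport
  simp only [sub_eq_add_neg, fderiv_comp_add_right] at htest ⊢
  rw [htest, neg_neg]

theorem translation_eq_add_integral (h : HasWeakPartial i f g) (t : ℝ) :
    Plate.translation (t • EuclideanSpace.single i 1) f
      = f + ∫ s in (0 : ℝ)..t, Plate.translation (s • EuclideanSpace.single i 1) g := by
  have hg : Continuous fun s : ℝ => Plate.translation (s • EuclideanSpace.single i 1) g :=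
    (continuous_translation ENNReal.ofNat_ne_top g).comp (by fun_prop)
  refine ext_of_inner_test fun ψ hψ => ?_
  have hftc := intervalIntegral.integral_eq_sub_of_hasDerivAt (a := 0) (b := t)
    (fun s _ => h.hasDerivAt_inner_translation hψ s)
    ((hg.inner continuous_const).intervalIntegrable 0 t)
  have hinner := (innerSL ℝ hψ.toL2).intervalIntegral_comp_comm
    (hg.intervalIntegrable (μ := volume) 0 t)
  simp only [innerSL_apply_apply, real_inner_comm _ hψ.toL2] at hinner
  rw [zero_smul, translation_zero] at hftc
  rw [inner_add_left, ← hinner, hftc, add_sub_cancel]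

theorem hasDerivAt_translation (h : HasWeakPartial i f g) :
    HasDerivAt (fun s : ℝ => Plate.translation (s • EuclideanSpace.single i 1) f) g 0 := by
  have hg : Continuous fun s : ℝ => Plate.translation (s • EuclideanSpace.single i 1) g :=
    (continuous_translation ENNReal.ofNat_ne_top g).comp (by fun_prop)
  have hintegral := (hg.integral_hasStrictDerivAt 0 0).hasDerivAt.const_add f
  rw [zero_smul, translation_zero] at hintegral
  exact hintegral.congr_of_eventuallyEq (Eventually.of_forall h.translation_eq_add_integral)

/-- Differentiate the identity `⟪τₛ f, τₛ f'⟫ = ⟪f, f'⟫`, where `τₛ` is the translation by `s eᵢ`;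
no approximation by test functions is needed. -/
theorem inner_eq_neg_inner (h : HasWeakPartial i f g) (h' : HasWeakPartial i f' g') :
    ⟪g, f'⟫_ℝ = -⟪f, g'⟫_ℝ := by
  have hderiv := h.hasDerivAt_translation.inner ℝ h'.hasDerivAt_translation
  simp only [LinearIsometry.inner_map_map, zero_smul, translation_zero] at hderiv
  linarith [hderiv.unique (hasDerivAt_const _ _)]

/-- Integrating by parts twice, without a third derivative: the second integration by parts is
done on difference quotients, in which the translations can be moved across the inner product. -/
theorem inner_partial_comm {fi fj gi gj : L2 n} (hfi : HasWeakPartial i f fi)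
    (hfj : HasWeakPartial j f fj) (hgi : HasWeakPartial i g gi) (hgj : HasWeakPartial j g gj) :
    ⟪fi, gj⟫_ℝ = ⟪fj, gi⟫_ℝ := by
  set e : Rn n := EuclideanSpace.single j 1
  have hparts : ∀ s : ℝ,
      ⟪fi, Plate.translation (s • e) g⟫_ℝ = -⟪Plate.translation ((-s) • e) f, gi⟫_ℝ := by
    intro s
    rw [inner_translation_left, neg_smul, neg_neg]
    exact hfi.inner_eq_neg_inner (hgi.translation _)
  have hright : HasDerivAt (fun s : ℝ => ⟪fi, Plate.translation (s • e) g⟫_ℝ) ⟪fi, gj⟫_ℝ 0 := by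
    simpa using (hasDerivAt_const (0 : ℝ) fi).inner ℝ hgj.hasDerivAt_translation
  have hleft : HasDerivAt (fun s : ℝ => ⟪fi, Plate.translation (s • e) g⟫_ℝ) ⟪fj, gi⟫_ℝ 0 := by
    simp only [hparts]
    have hneg : HasDerivAt (fun s : ℝ => Plate.translation ((-s) • e) f) (-fj) 0 := by
      have h0 := hfj.hasDerivAt_translation
      rw [← neg_zero] at h0
      exact (h0.scomp 0 (hasDerivAt_neg 0)).congr_deriv (neg_one_smul ℝ fj)
    refine (hneg.inner ℝ (hasDerivAt_const 0 gi)).neg.congr_deriv ?_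
    rw [inner_zero_right, zero_add, inner_neg_left, neg_neg]
  exact hright.unique hleft

end HasWeakPartial

end WeakDerivatives

section SobolevSpace

variable {n : ℕ}

/-- The weak partial derivative `∂ᵢ f` of `f ∈ H²`. -/
def grad (f : H2 n) (i : Fin n) : L2 n := f.1.2.1 i

/-- The weak second partial derivative `∂ⱼ ∂ᵢ f` of `f ∈ H²`. -/
def hessian (f : H2 n) (i j : Fin n) : L2 n := f.1.2.2 i j

theorem hasWeakPartial_grad (f : H2 n) (i : Fin n) : HasWeakPartial i (toL2 f) (grad f i) :=
  f.2.1 i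

theorem hasWeakPartial_hessian (f : H2 n) (i j : Fin n) :
    HasWeakPartial j (grad f i) (hessian f i j) :=
  f.2.2 i j

theorem hessian_comm (f : H2 n) (i j : Fin n) : hessian f i j = hessian f j i :=
  (hasWeakPartial_grad f i).partial_comm (hasWeakPartial_grad f j) (hasWeakPartial_hessian f i j)
    (hasWeakPartial_hessian f j i)

theorem isClosed_H2 : IsClosed (H2 n : Set (L2 n × (Fin n → L2 n) × (Fin n → Fin n → L2 n))) := by
  have hH2 : (H2 n : Set (L2 n × (Fin n → L2 n) × (Fin n → Fin n → L2 n)))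
      = (⋂ i, (fun p => (p.1, p.2.1 i)) ⁻¹' {q | HasWeakPartial i q.1 q.2}) ∩
        ⋂ i, ⋂ j, (fun p => (p.2.1 i, p.2.2 i j)) ⁻¹' {q | HasWeakPartial j q.1 q.2} := by
    ext p
    simp [H2]
  rw [hH2]
  exact (isClosed_iInter fun i => (isClosed_hasWeakPartial i).preimage (by fun_prop)).inter
    (isClosed_iInter fun i => isClosed_iInter fun j =>
      (isClosed_hasWeakPartial j).preimage (by fun_prop))

instance : CompleteSpace (H2 n) := isClosed_H2.completeSpace_coe

/-- The inclusion of `H²` into `L²` as a continuous linear map. -/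
noncomputable def toL2L (n : ℕ) : H2 n →L[ℝ] L2 n :=
  ContinuousLinearMap.fst ℝ _ _ ∘L (H2 n).subtypeL

/-- The weak Laplacian as a continuous linear map. -/
noncomputable def laplacianL (n : ℕ) : H2 n →L[ℝ] L2 n where
  toFun := laplacian
  map_add' _ _ := Finset.sum_add_distrib
  map_smul' c f := (Finset.smul_sum (r := c) (f := fun i => hessian f i i)).symm
  cont := continuous_finsetSum _ fun _ _ => by fun_prop

theorem injective_toL2L : Function.Injective (toL2L n) := by
  rintro ⟨⟨f, g, h⟩, hf⟩ ⟨⟨f', g', h'⟩, hf'⟩ (rfl : f = f')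
  obtain rfl : g = g' := funext fun i => (hf.1 i).unique (hf'.1 i)
  obtain rfl : h = h' := funext₂ fun i j => (hf.2 i j).unique (hf'.2 i j)
  rfl

/-- A test function as an element of `H²`. -/
noncomputable def IsTest.toH2 {ψ : Rn n → ℝ} (hψ : IsTest ψ) : H2 n :=
  ⟨(hψ.toL2, fun i => (hψ.partialDeriv i).toL2,
    fun i j => ((hψ.partialDeriv i).partialDeriv j).toL2),
    fun i => hψ.hasWeakPartial i, fun i j => (hψ.partialDeriv i).hasWeakPartial j⟩

theorem denseRange_toL2L : DenseRange (toL2L n) := by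
  have horth : ((toL2L n).range)ᗮ = ⊥ := by
    refine (Submodule.eq_bot_iff _).2 fun z hz => ext_of_inner_test fun ψ hψ => ?_
    rw [inner_zero_left]
    exact (Submodule.mem_orthogonal' _ z).1 hz _ ⟨hψ.toH2, rfl⟩
  exact Submodule.dense_iff_topologicalClosure_eq_top.2
    (Submodule.topologicalClosure_eq_top_iff.2 horth)

theorem sum_norm_hessian_sq (f : H2 n) : ∑ i, ∑ j, ‖hessian f i j‖ ^ 2 = ‖laplacian f‖ ^ 2 := by
  have hlap : laplacian f = ∑ i, hessian f i i := rfl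
  rw [← real_inner_self_eq_norm_sq, hlap, sum_inner]
  refine Finset.sum_congr rfl fun i _ => ?_
  rw [inner_sum]
  refine Finset.sum_congr rfl fun j _ => ?_
  rw [(hasWeakPartial_hessian f i i).inner_partial_comm (hasWeakPartial_hessian f i j)
    (hasWeakPartial_hessian f j i) (hasWeakPartial_hessian f j j), hessian_comm f j i,
    real_inner_self_eq_norm_sq]

theorem norm_hessian_le (f : H2 n) (i j : Fin n) : ‖hessian f i j‖ ≤ ‖laplacian f‖ := by
  refine le_of_sq_le_sq ?_ (norm_nonneg _)
  calc ‖hessian f i j‖ ^ 2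
      ≤ ∑ j, ‖hessian f i j‖ ^ 2 :=
        Finset.single_le_sum (f := fun j => ‖hessian f i j‖ ^ 2) (fun _ _ => sq_nonneg _)
          (Finset.mem_univ j)
    _ ≤ ∑ i, ∑ j, ‖hessian f i j‖ ^ 2 :=
        Finset.single_le_sum (f := fun i => ∑ j, ‖hessian f i j‖ ^ 2)
          (fun _ _ => Finset.sum_nonneg fun _ _ => sq_nonneg _) (Finset.mem_univ i)
    _ = ‖laplacian f‖ ^ 2 := sum_norm_hessian_sq f

theorem norm_grad_le (f : H2 n) (i : Fin n) : ‖grad f i‖ ≤ ‖toL2 f‖ + ‖laplacian f‖ := by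
  have hsq : ‖grad f i‖ ^ 2 ≤ ‖toL2 f‖ * ‖laplacian f‖ :=
    calc ‖grad f i‖ ^ 2 = -⟪toL2 f, hessian f i i⟫_ℝ := by
          rw [← real_inner_self_eq_norm_sq]
          exact (hasWeakPartial_grad f i).inner_eq_neg_inner (hasWeakPartial_hessian f i i)
      _ ≤ ‖toL2 f‖ * ‖hessian f i i‖ := (neg_le_abs _).trans (abs_real_inner_le_norm _ _)
      _ ≤ ‖toL2 f‖ * ‖laplacian f‖ := by
          gcongr
          exact norm_hessian_le f i i
  refine le_of_sq_le_sq ?_ (by positivity)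
  nlinarith [norm_nonneg (toL2 f), norm_nonneg (laplacian f)]

theorem norm_le_norm_toL2_add_norm_laplacian (f : H2 n) : ‖f‖ ≤ ‖toL2 f‖ + ‖laplacian f‖ := by
  have hsum : 0 ≤ ‖toL2 f‖ + ‖laplacian f‖ := by positivity
  refine norm_prod_le_iff.2 ⟨le_add_of_nonneg_right (norm_nonneg _), norm_prod_le_iff.2
    ⟨(pi_norm_le_iff_of_nonneg hsum).2 (norm_grad_le f), (pi_norm_le_iff_of_nonneg hsum).2
      fun i => (pi_norm_le_iff_of_nonneg hsum).2 fun j => ?_⟩⟩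
  exact (norm_hessian_le f i j).trans (le_add_of_nonneg_left (norm_nonneg _))

end SobolevSpace

section Potential

variable {α : Type*} [MeasurableSpace α] {μ : Measure α} {V : α → ℝ}

/-- Multiplication by an essentially bounded function on `L²`. -/
noncomputable def mulL (hV : MemLp V ⊤ μ) : Lp ℝ 2 μ →L[ℝ] Lp ℝ 2 μ :=
  (ContinuousLinearMap.mul ℝ ℝ).holderL μ ⊤ 2 2 (hV.toLp V)

theorem coeFn_mulL (hV : MemLp V ⊤ μ) (f : Lp ℝ 2 μ) : mulL hV f =ᵐ[μ] fun x => V x * f x := by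
  have hholder : mulL hV f =ᵐ[μ] fun x => hV.toLp V x * f x :=
    (ContinuousLinearMap.mul ℝ ℝ).coeFn_holder (r := 2) (hV.toLp V) f
  filter_upwards [hholder, hV.coeFn_toLp] with x hx hVx
  rw [hx, hVx]

theorem inner_mulL (hV : MemLp V ⊤ μ) (f g : Lp ℝ 2 μ) :
    ⟪mulL hV f, g⟫_ℝ = ∫ x, V x * f x * g x ∂μ := by
  rw [L2.inner_def]
  refine integral_congr_ae ?_
  filter_upwards [coeFn_mulL hV f] with x hx
  rw [hx, RCLike.inner_apply, conj_trivial, mul_comm]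

theorem inner_mulL_comm (hV : MemLp V ⊤ μ) (f g : Lp ℝ 2 μ) :
    ⟪mulL hV f, g⟫_ℝ = ⟪mulL hV g, f⟫_ℝ := by
  simp only [inner_mulL, mul_right_comm]

theorem inner_mulL_self_nonneg (hV : MemLp V ⊤ μ) (hV0 : 0 ≤ V) (f : Lp ℝ 2 μ) :
    0 ≤ ⟪mulL hV f, f⟫_ℝ := by
  rw [inner_mulL]
  refine integral_nonneg fun x => ?_
  rw [mul_assoc]
  exact mul_nonneg (hV0 x) (mul_self_nonneg _)

theorem integrable_mul_mul_self (hV : MemLp V ⊤ μ) (f : Lp ℝ 2 μ) :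
    Integrable (fun x => V x * f x * f x) μ := by
  refine ((Lp.memLp (mulL hV f)).integrable_mul (Lp.memLp f)).congr ?_
  filter_upwards [coeFn_mulL hV f] with x hx
  rw [Pi.mul_apply, hx]

theorem two_mul_inner_le (hV : MemLp V ⊤ μ) (hpos : ∀ x, 0 < V x) {f : Lp ℝ 2 μ}
    (hf : Integrable (fun x => |f x| ^ 2 / V x) μ) (g : Lp ℝ 2 μ) :
    2 * ⟪f, g⟫_ℝ ≤ (∫ x, |f x| ^ 2 / V x ∂μ) + ⟪mulL hV g, g⟫_ℝ := by
  rw [inner_mulL, L2.inner_def, ← integral_const_mul,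
    ← integral_add hf (integrable_mul_mul_self hV g)]
  refine integral_mono ((L2.integrable_inner (𝕜 := ℝ) f g).const_mul 2)
    (hf.add (integrable_mul_mul_self hV g)) fun x => ?_
  have hsq : |f x| ^ 2 / V x + V x * g x * g x - 2 * (g x * f x)
      = (f x - V x * g x) ^ 2 / V x := by
    have := (hpos x).ne'
    rw [sq_abs]
    field_simp
    ring
  have hnonneg := div_nonneg (sq_nonneg (f x - V x * g x)) (hpos x).le
  rw [← hsq] at hnonneg
  exact sub_nonneg.1 hnonneg

end Potential

section Plate

variable {n : ℕ}

theorem memLp_top (V : Rn n →ᵇ ℝ) : MemLp V ⊤ (volume : Measure (Rn n)) :=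
  memLp_top_of_bound V.continuous.aestronglyMeasurable ‖V‖
    (Eventually.of_forall V.norm_coe_le_norm)

/-- The form `∫ Δu Δφ + ∫ V u φ` on `H²` of the plate operator `Δ² + V`. -/
noncomputable def plateForm (V : Rn n →ᵇ ℝ) : H2 n →L[ℝ] H2 n →L[ℝ] ℝ :=
  energyForm (toL2L n) (laplacianL n) (mulL (memLp_top V))

variable {V : Rn n →ᵇ ℝ}

theorem plateForm_comm (f g : H2 n) : plateForm V f g = plateForm V g f := by
  rw [plateForm, energyForm_apply, energyForm_apply, real_inner_comm, inner_mulL_comm]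

theorem inner_mulL_toL2_le_plateForm (f : H2 n) :
    ⟪mulL (memLp_top V) (toL2 f), toL2 f⟫_ℝ ≤ plateForm V f f := by
  rw [plateForm, energyForm_apply]
  exact le_add_of_nonneg_left real_inner_self_nonneg

theorem plateForm_self_nonneg (hV : ∀ x, 0 ≤ V x) (f : H2 n) : 0 ≤ plateForm V f f :=
  (inner_mulL_self_nonneg (memLp_top V) hV _).trans (inner_mulL_toL2_le_plateForm f)

theorem isPlateSolution_iff {u₀ : H2 n} {u₁ : L2 n} {u : ℝ → H2 n} : IsPlateSolution V u₀ u₁ u ↔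
    ∃ v, IsWaveSolution (toL2L n) (plateForm V) u v ∧ u 0 = u₀ ∧ v 0 = u₁ := by
  have hform : ∀ f g : H2 n, plateForm V f g
      = ⟪laplacian f, laplacian g⟫_ℝ + ∫ x, V x * toL2 f x * toL2 g x := fun f g => by
    rw [← inner_mulL (memLp_top V)]
    rfl
  constructor
  · rintro ⟨hu, hu₀, v, hv, hv₀, hderiv, hweak⟩
    exact ⟨v, ⟨hu, hv, hderiv, by simp only [hform]; exact hweak⟩, hu₀, hv₀⟩
  · rintro ⟨v, huv, hu₀, hv₀⟩
    have hweak := huv.hasDerivWithinAt_inner_velocity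
    simp only [hform] at hweak
    exact ⟨huv.continuousOn, hu₀, v, huv.continuousOn_velocity, hv₀, huv.hasDerivWithinAt, hweak⟩

theorem exists_isPlateSolution (V : Rn n →ᵇ ℝ) (u₀ : H2 n) (u₁ : L2 n) :
    ∃ u, IsPlateSolution V u₀ u₁ u := by
  obtain ⟨u, hu⟩ := exists_isWaveSolution injective_toL2L denseRange_toL2L (L := laplacianL n)
    (c := 1) (fun f => by rw [one_mul]; exact norm_le_norm_toL2_add_norm_laplacian f)
    (mulL (memLp_top V)) u₀ u₁
  exact ⟨u, isPlateSolution_iff.2 hu⟩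

theorem IsPlateSolution.norm_sq_le (hV : ∀ x, 0 < V x) {u₀ : H2 n} {u₁ : L2 n} {u : ℝ → H2 n}
    (hu : IsPlateSolution V u₀ u₁ u) (hu₁ : Integrable (fun x => |u₁ x| ^ 2 / V x)) {t : ℝ}
    (ht : 0 ≤ t) : ‖toL2 (u t)‖ ^ 2 ≤ ‖toL2 u₀‖ ^ 2 + ∫ x, |u₁ x| ^ 2 / V x := by
  obtain ⟨v, huv, rfl, rfl⟩ := isPlateSolution_iff.1 hu
  exact huv.norm_sq_le plateForm_comm (fun w => (two_mul_inner_le (memLp_top V) hV hu₁ _).trans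
    (add_le_add_right (inner_mulL_toL2_le_plateForm w) _)) ht

theorem IsPlateSolution.eqOn (hV : ∀ x, 0 ≤ V x) {u₀ : H2 n} {u₁ : L2 n} {u w : ℝ → H2 n}
    (hu : IsPlateSolution V u₀ u₁ u) (hw : IsPlateSolution V u₀ u₁ w) : EqOn u w (Ici 0) := by
  obtain ⟨v, huv, hu₀, hv₀⟩ := isPlateSolution_iff.1 hu
  obtain ⟨v', hwv', hw₀, hv'₀⟩ := isPlateSolution_iff.1 hw
  exact huv.eqOn hwv' plateForm_comm (plateForm_self_nonneg hV) injective_toL2L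
    (hu₀.trans hw₀.symm) (hv₀.trans hv'₀.symm)

end Plate

end Plate

theorem theorem1p7 :
    ∃ C : ℝ, 0 < C ∧
      ∀ (n : ℕ), 1 ≤ n →
      ∀ (V : BoundedContinuousFunction (Plate.Rn n) ℝ), (∀ x, 0 < V x) →
      ∀ (u₀ : Plate.H2 n) (u₁ : Plate.L2 n),
        Integrable (fun x => |u₁ x| ^ 2 / V x) volume →
        ∃ u : ℝ → Plate.H2 n,
          Plate.IsPlateSolution V u₀ u₁ u ∧
          (∀ w : ℝ → Plate.H2 n, Plate.IsPlateSolution V u₀ u₁ w → EqOn w u (Ici 0)) ∧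
          ∀ t : ℝ, 0 ≤ t →
            ‖Plate.toL2 (u t)‖ ^ 2 ≤ C * (‖Plate.toL2 u₀‖ ^ 2 + ∫ x, |u₁ x| ^ 2 / V x) := by
  refine ⟨1, one_pos, fun n _ V hV u₀ u₁ hu₁ => ?_⟩
  obtain ⟨u, hu⟩ := Plate.exists_isPlateSolution V u₀ u₁
  refine ⟨u, hu, fun w hw => hw.eqOn (fun x => (hV x).le) hu, fun t ht => ?_⟩
  rw [one_mul]
  exact hu.norm_sq_le hV hu₁ ht
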